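/- **Lemma 2.3.** Let $\alpha\in(0,1)$. There is a constant $C>0$, depending only on $\alpha$, such that the following holds. Let $\varphi_0\in(0,\pi/2)$, let $K(\varphi_0)=\{\zeta\in\mathbb{C}\setminus\{0\} : |\arg\zeta|<\varphi_0\}$, and let $\lambda\in\mathbb{C}$ satisfy $-\lambda\in\overline{K(\varphi_0)}$. Let $T>0$, let $1\le n\le N$ be integers, and put $\Delta t=T/N$ and $t_j=j\,\Delta t$. Let $$v(t)=E_\alpha(\lambda t^\alpha),\qquad E_\alpha(z)=\sum_{k=0}^\infty\frac{z^k}{\Gamma(\alpha k+1)},\qquad \partial^\alpha v(t)=\frac{1}{\Gamma(1-\alpha)}\int_0^t\frac{v'(s)}{(t-s)^\alpha}\,ds$$ ($\partial^\alpha v$ is the Caputo derivative of order $\alpha$ of $v$), and let $$b_{jn}=\int_{j-1}^{j}\frac{dx}{x^{1-\alpha}(n-x)^\alpha},\qquad 1\le j\le n.$$ Then $\partial^\alpha v(t_n)$ is well defined ($v$ is differentiable on $(0,t_n)$ and the integral converges absolutely), and $$\left|\partial^\alpha v(t_n)-\frac{\alpha}{\Gamma(1-\alpha)}\sum_{j=1}^n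 b_{jn}\,\frac{v(t_j)-v(t_{j-1})}{t_j^\alpha-t_{j-1}^\alpha}\right|\le C\,\eta(n)\,|\lambda|^2(\Delta t)^\alpha\bigl(1+|\lambda|(\Delta t)^\alpha\bigr),$$ where $$\eta(n)=\begin{cases} n^{-\alpha}, & \alpha\in(0,1/2),\\ n^{-1/2}\ln(n+1), & \alpha=1/2,\\ n^{-1+\alpha}, & \alpha\in(1/2,1).\end{cases}$$ -/

import Mathlib

noncomputable section

namespace FracCaputo

/-- The open sector `K(φ) = {ζ ∈ ℂ \ {0} : |arg ζ| < φ}`. -/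
def sector (φ : ℝ) : Set ℂ := {ζ : ℂ | ζ ≠ 0 ∧ |Complex.arg ζ| < φ}

/-- The Mittag-Leffler function `E_α(z) = ∑_{k ≥ 0} z ^ k / Γ(α k + 1)`. -/
def mittagLeffler (α : ℝ) (z : ℂ) : ℂ :=
  ∑' k : ℕ, z ^ k / ((Real.Gamma (α * k + 1) : ℝ) : ℂ)

/-- The integrand `u(s) / (t - s)^{1 - β}` of the Riemann-Liouville integral of order `β`. -/
def rlIntegrand (β : ℝ) (u : ℝ → ℂ) (t s : ℝ) : ℂ :=
  u s / (((t - s) ^ (1 - β) : ℝ) : ℂ)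

/-- The Riemann-Liouville fractional integral of order `β`,
`(I^β u)(t) = 1 / Γ(β) * ∫_0^t u(s) / (t - s)^{1 - β} ds`. -/
def rlIntegral (β : ℝ) (u : ℝ → ℂ) (t : ℝ) : ℂ :=
  1 / ((Real.Gamma β : ℝ) : ℂ) * ∫ s in (0 : ℝ)..t, rlIntegrand β u t s

/-- The Caputo fractional derivative `∂^α u = I^{1 - α} u'` of order `α ∈ (0, 1)`. -/
def caputoDeriv (α : ℝ) (u : ℝ → ℂ) (t : ℝ) : ℂ :=
  rlIntegral (1 - α) (deriv u) t

/-- The integral defining `∂^α u (t)` makes sense: `u` is differentiable on `(0, t)` and the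
integrand is (absolutely) integrable over `(0, t)`. -/
def CaputoDerivExists (α : ℝ) (u : ℝ → ℂ) (t : ℝ) : Prop :=
  (∀ s ∈ Set.Ioo 0 t, DifferentiableAt ℝ u s) ∧
    IntervalIntegrable (rlIntegrand (1 - α) (deriv u) t) MeasureTheory.volume 0 t

/-- The function `v(t) = E_α(λ t^α)`, `t ≥ 0`. -/
def mlSolution (α : ℝ) (lam : ℂ) (t : ℝ) : ℂ :=
  mittagLeffler α (lam * ((t ^ α : ℝ) : ℂ))

/-- The coefficients `b_{jn} = ∫_{j-1}^j dx / (x^{1-α} (n - x)^α)`, for `1 ≤ j ≤ n`. -/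
def coeffB (α : ℝ) (j n : ℕ) : ℝ :=
  ∫ x in ((j : ℝ) - 1)..(j : ℝ), 1 / (x ^ (1 - α) * ((n : ℝ) - x) ^ α)

/-- The node `t_j = j Δt` of the uniform grid with step `dt`. -/
def node (dt : ℝ) (j : ℕ) : ℝ := j * dt

/-- The discrete approximation of `∂^α v (t_n)`,
`α / Γ(1 - α) * ∑_{j=1}^n b_{jn} (v(t_j) - v(t_{j-1})) / (t_j^α - t_{j-1}^α)`.
The subtraction `j - 1` is only used for `j ≥ 1`. -/
def discreteCaputo (α : ℝ) (v : ℝ → ℂ) (dt : ℝ) (n : ℕ) : ℂ :=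
  ((α / Real.Gamma (1 - α) : ℝ) : ℂ) *
    ∑ j ∈ Finset.Icc 1 n, ((coeffB α j n : ℝ) : ℂ) *
      ((v (node dt j) - v (node dt (j - 1))) /
        ((node dt j ^ α - node dt (j - 1) ^ α : ℝ) : ℂ))

/-- The rate `η(n)`: `n^{-α}`, `n^{-1/2} log (n + 1)` or `n^{-1+α}` according as
`α < 1/2`, `α = 1/2` or `α > 1/2`. -/
def eta (α : ℝ) (n : ℕ) : ℝ :=
  if α < 1 / 2 then (n : ℝ) ^ (-α)
  else if α = 1 / 2 then (n : ℝ) ^ (-(1 / 2) : ℝ) * Real.log ((n : ℝ) + 1)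
  else (n : ℝ) ^ (-1 + α)

end FracCaputo

end

/-!
Write `v(t) = E_α(λ t ^ α)`. The substitution `r = s ^ α` turns `v` into the entire function
`r ↦ E_α(λ r)`, and the weight `b_{jn}` is exactly what makes the scheme replace
`λ E_α'(λ s ^ α)` on the `j`-th cell by the difference quotient of `r ↦ E_α(λ r)` between
`t_{j-1} ^ α` and `t_j ^ α`. If `E_α'` is Lipschitz on the closed left half-plane, with constant
`L`, the local error is therefore at most `α L |λ|² (t_j ^ α - t_{j-1} ^ α) b_{jn}`
(`norm_integral_cell_sub_le`), and it remains to see that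
`∑ j, (j ^ α - (j - 1) ^ α) b_{jn} ≤ C η(n)`.

The Lipschitz bound (`norm_mittagLefflerDeriv_sub_le`, with `L = E_α''(0) = 2 / Γ(2α + 1)`)
expresses that `E_α(z) = ∫ exp (z x) dμ(x)` for a probability measure `μ` on `[0, ∞)`, the
Mittag-Leffler distribution. Instead of constructing `μ`, the argument uses a discrete
approximation. With `A_n(s) = ∏_{i=1}^n (s + i) / i`, the polynomial `y ↦ A_n(α y)` is a
combination of the `binom (y + j, j)`, `j ≤ n`, with nonnegative coefficients, by induction on `n`
(`exists_risingBinom_eq_sum`; the recursion is that of the table counts in a Chinese restaurant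
process). Hence `∑ k, A_n(α k) z ^ k` is a nonnegative combination of the `(1 - z) ^ (-(j + 1))`,
whose derivatives are Lipschitz on the left half-plane with constant the second derivative at `0`.
Replacing `z` by `z / n ^ α` and letting `n → ∞`, the coefficients `A_n(α k) / n ^ (α k)` decrease
to `1 / Γ(α k + 1)` by Euler's limit formula, and dominated convergence gives the claim for `E_α`.

For the sum (`exists_sum_succ_rpow_sub_mul_coeffB_le_eta`), `j ^ α - (j - 1) ^ α ≤ j ^ (α - 1)`.
The cells with `2 j ≤ n` have `b_{jn} ≤ (n / 2) ^ (-α) j ^ (α - 1) / α` and contribute a multiple of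
`n ^ (-α) ∑ j, j ^ (2 α - 2)`, which produces the three cases of `η`. In the other cells
`j ^ (α - 1) ≤ (n / 2) ^ (α - 1)`, while `∑ j, b_{jn}` is the Beta integral, independent of `n`.
-/

namespace FracCaputo

open Filter Topology Finset MeasureTheory

/-! ### Discrete approximations of the Mittag-Leffler function -/

/-- The generalized binomial coefficient `binom (s + n) n = ∏_{i=1}^n (s + i) / i`, for real `s`. -/
noncomputable def risingBinom (n : ℕ) (s : ℝ) : ℝ := ∏ i ∈ range n, (s + i + 1) / (i + 1)

lemma risingBinom_succ (n : ℕ) (s : ℝ) :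
    risingBinom (n + 1) s = risingBinom n s * ((s + n + 1) / (n + 1)) := prod_range_succ _ _

lemma risingBinom_pos {s : ℝ} (hs : 0 ≤ s) (n : ℕ) : 0 < risingBinom n s :=
  prod_pos fun i _ => by positivity

/-- The polynomial `y ↦ risingBinom n (α y)` has nonnegative coefficients in the basis
`binom (y + j, j)`: multiplying `binom (y + j, j)` by `α y + n + 1` gives
`α (j + 1) binom (y + j + 1, j + 1) + (n + 1 - α (j + 1)) binom (y + j, j)`, and `α (j + 1) ≤ n + 1`
for `j ≤ n`. -/
lemma exists_risingBinom_eq_sum {α : ℝ} (h0 : 0 ≤ α) (h1 : α ≤ 1) (n : ℕ) :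
    ∃ P : ℕ → ℝ, (∀ j, 0 ≤ P j) ∧
      ∀ k : ℕ, risingBinom n (α * k) = ∑ j ∈ range (n + 1), P j * ((k + j).choose j : ℝ) := by
  induction n with
  | zero => exact ⟨fun _ => 1, fun _ => zero_le_one, fun k => by simp [risingBinom]⟩
  | succ n ih =>
    obtain ⟨P, hP, h⟩ := ih
    refine ⟨fun j => ((if j = 0 then 0 else P (j - 1) * (α * j)) +
      (if j ≤ n then P j * (n + 1 - α * (j + 1)) else 0)) / (n + 1), fun j => ?_, fun k => ?_⟩
    · refine div_nonneg (add_nonneg ?_ ?_) (by positivity)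
      · split_ifs
        · exact le_rfl
        · exact mul_nonneg (hP _) (by positivity)
      · split_ifs with hj
        · refine mul_nonneg (hP _) ?_
          have : (j : ℝ) ≤ n := by exact_mod_cast hj
          nlinarith
        · exact le_rfl
    · have hn : (n + 1 : ℝ) ≠ 0 := by positivity
      have split : ∀ j, P j * ((k + j).choose j : ℝ) * (α * k + n + 1) =
          P j * (α * ((j + 1 : ℕ) : ℝ)) * ((k + (j + 1)).choose (j + 1) : ℝ) +
            P j * (n + 1 - α * (j + 1)) * ((k + j).choose j : ℝ) := by
        intro j
        have : ((k + j : ℕ) + 1 : ℝ) * ((k + j).choose j : ℝ) =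
            ((k + j + 1).choose (j + 1) : ℝ) * (j + 1) := by
          exact_mod_cast Nat.add_one_mul_choose_eq (k + j) j
        push_cast at this ⊢
        rw [← add_assoc]
        linear_combination P j * α * this
      rw [risingBinom_succ, h, mul_div_assoc', sum_mul, sum_congr rfl fun j _ => split j,
        sum_add_distrib]
      simp only [add_div, add_mul, sum_add_distrib]
      congr 1
      · rw [sum_range_succ' _ (n + 1), sum_div]
        simp only [if_neg (Nat.succ_ne_zero _), Nat.add_sub_cancel]
        simp [div_mul_eq_mul_div]
      · rw [sum_range_succ _ (n + 1), sum_div]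
        simp only [if_neg (Nat.not_succ_le_self n)]
        rw [zero_div, zero_mul, add_zero]
        refine sum_congr rfl fun j hj => ?_
        rw [if_pos (Nat.lt_succ_iff.mp (mem_range.mp hj)), div_mul_eq_mul_div]

lemma hasSum_succ_mul_choose_mul_pow (j : ℕ) {z : ℂ} (hz : ‖z‖ < 1) :
    HasSum (fun k : ℕ => (k + 1 : ℂ) * ((k + 1 + j).choose j : ℂ) * z ^ k)
      ((j + 1) / (1 - z) ^ (j + 2)) := by
  have := (hasSum_choose_mul_geometric_of_norm_lt_one (j + 1) hz).mul_left (j + 1 : ℂ)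
  rw [mul_one_div] at this
  refine this.congr_fun fun k => ?_
  have : ((k + j : ℕ) + 1 : ℂ) * ((k + j).choose k : ℂ) =
      ((k + j + 1).choose (k + 1) : ℂ) * (k + 1) := by
    exact_mod_cast Nat.add_one_mul_choose_eq (k + j) k
  have h2 : ((k + j + 1 : ℕ) : ℂ) * ((k + j).choose j : ℂ) =
      ((k + j + 1).choose (j + 1) : ℂ) * (j + 1) := by
    exact_mod_cast Nat.add_one_mul_choose_eq (k + j) j
  rw [Nat.choose_symm_add] at this
  rw [show k + 1 + j = (k + 1) + j from rfl, ← Nat.choose_symm_add, add_right_comm k 1 j,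
    ← add_assoc k j 1]
  push_cast at this h2
  linear_combination z ^ k * (h2 - this)

lemma norm_inv_pow_sub_inv_pow_le {a b : ℂ} (ha : 1 ≤ ‖a‖) (hb : 1 ≤ ‖b‖) (m : ℕ) :
    ‖1 / a ^ m - 1 / b ^ m‖ ≤ m * ‖a - b‖ := by
  have ha0 : a ≠ 0 := norm_pos_iff.mp (by linarith)
  have hb0 : b ≠ 0 := norm_pos_iff.mp (by linarith)
  have ha' : ‖a⁻¹‖ ≤ 1 := by rw [norm_inv]; exact inv_le_one_of_one_le₀ ha
  have hb' : ‖b⁻¹‖ ≤ 1 := by rw [norm_inv]; exact inv_le_one_of_one_le₀ hb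
  have hab : ‖a⁻¹ - b⁻¹‖ ≤ ‖a - b‖ := by
    rw [inv_sub_inv ha0 hb0, norm_div, norm_mul, norm_sub_rev]
    exact div_le_self (norm_nonneg _) (one_le_mul_of_one_le_of_one_le ha hb)
  rw [one_div, one_div, ← inv_pow, ← inv_pow, ← (Commute.all a⁻¹ b⁻¹).geom_sum₂_mul, norm_mul]
  refine mul_le_mul ?_ hab (norm_nonneg _) (by positivity)
  refine (norm_sum_le _ _).trans ((sum_le_card_nsmul _ _ 1 fun i _ => ?_).trans (by simp))
  rw [norm_mul, norm_pow, norm_pow]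
  exact mul_le_one₀ (pow_le_one₀ (norm_nonneg _) ha') (by positivity)
    (pow_le_one₀ (norm_nonneg _) hb')

/-- The power series `∑ binom (α k + n, n) z ^ k` is a nonnegative combination of the functions
`(1 - z) ^ (-(j + 1))`, so on the left half of the unit disc its derivative is Lipschitz with the
constant given by its second derivative at the origin. -/
lemma exists_hasSum_risingBinom {α : ℝ} (h0 : 0 ≤ α) (h1 : α ≤ 1) (n : ℕ) :
    ∃ F : ℂ → ℂ,
      (∀ z : ℂ, ‖z‖ < 1 → HasSum
        (fun k : ℕ => (k + 1 : ℂ) * (risingBinom n (α * (k + 1)) : ℝ) * z ^ k) (F z)) ∧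
      ∀ z w : ℂ, z.re ≤ 0 → w.re ≤ 0 → ‖F z - F w‖ ≤ 2 * risingBinom n (α * 2) * ‖z - w‖ := by
  obtain ⟨P, hP, h⟩ := exists_risingBinom_eq_sum h0 h1 n
  refine ⟨fun z => ∑ j ∈ range (n + 1), P j * ((j + 1) / (1 - z) ^ (j + 2)), fun z hz => ?_,
    fun z w hz hw => ?_⟩
  · have := hasSum_sum (s := range (n + 1)) fun j _ =>
      (hasSum_succ_mul_choose_mul_pow j hz).mul_left (P j : ℂ)
    refine this.congr_fun fun k => ?_
    have hk := h (k + 1)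
    push_cast at hk
    rw [hk]
    push_cast
    rw [mul_sum, sum_mul]
    exact sum_congr rfl fun j _ => by ring
  · have h2 := h 2
    push_cast at h2
    have key : ∀ u : ℂ, u.re ≤ 0 → 1 ≤ ‖1 - u‖ := fun u hu => by
      refine le_trans ?_ (Complex.re_le_norm _)
      simp; linarith
    rw [← sum_sub_distrib, h2, mul_sum, sum_mul]
    refine (norm_sum_le _ _).trans (sum_le_sum fun j _ => ?_)
    have hc : 2 * ((2 + j).choose j : ℝ) = (j + 1) * (j + 2) := by
      have h1 : (j + 1 + 1) * (j + 1).choose 1 = (j + 1 + 1).choose 2 * 2 :=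
        Nat.add_one_mul_choose_eq (j + 1) 1
      rw [Nat.choose_one_right] at h1
      rw [← Nat.choose_symm_add, add_comm 2 j]
      have h1' : (j + 1 + 1 : ℝ) * (j + 1) = ((j + 2).choose 2 : ℝ) * 2 := by exact_mod_cast h1
      linear_combination -h1'
    have := norm_inv_pow_sub_inv_pow_le (key z hz) (key w hw) (j + 2)
    rw [sub_sub_sub_cancel_left, norm_sub_rev w z] at this
    rw [show (P j : ℂ) * ((j + 1) / (1 - z) ^ (j + 2)) - P j * ((j + 1) / (1 - w) ^ (j + 2)) =
      ((P j * (j + 1) : ℝ) : ℂ) * (1 / (1 - z) ^ (j + 2) - 1 / (1 - w) ^ (j + 2)) by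
        push_cast; ring, norm_mul, Complex.norm_of_nonneg (mul_nonneg (hP j) (by positivity))]
    refine (mul_le_mul_of_nonneg_left this (mul_nonneg (hP j) (by positivity))).trans_eq ?_
    push_cast
    linear_combination -P j * ‖z - w‖ * hc

lemma risingBinom_div_rpow_antitone {s : ℝ} (hs : 0 ≤ s) {m n : ℕ} (hm : 1 ≤ m) (hmn : m ≤ n) :
    risingBinom n s / (n : ℝ) ^ s ≤ risingBinom m s / (m : ℝ) ^ s := by
  induction n, hmn using Nat.le_induction with
  | base => exact le_rfl
  | succ n hn ih =>
    refine le_trans ?_ ih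
    have hn0 : (0 : ℝ) < n := by exact_mod_cast hm.trans hn
    have e1 : (n : ℝ) ^ s = (n + 1 : ℝ) ^ s * (1 - 1 / (n + 1)) ^ s := by
      rw [← Real.mul_rpow (by positivity)]
      · congr 1; field_simp; ring
      · rw [sub_nonneg, div_le_one (by positivity)]; linarith
    -- `(1 - 1 / (n + 1)) ^ s ≤ exp (-s / (n + 1)) ≤ 1 / (1 + s / (n + 1))` covers all `s ≥ 0`,
    -- without the case distinction at `s = 1` of Bernoulli's inequality.
    have e2 : (1 - 1 / (n + 1 : ℝ)) ^ s ≤ (n + 1) / (s + n + 1) := by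
      calc (1 - 1 / (n + 1 : ℝ)) ^ s ≤ (Real.exp (-(1 / (n + 1)))) ^ s := by
            refine Real.rpow_le_rpow ?_ (Real.one_sub_le_exp_neg _) hs
            rw [sub_nonneg, div_le_one (by positivity)]; linarith
        _ = (Real.exp (s / (n + 1)))⁻¹ := by
            rw [← Real.exp_mul, ← Real.exp_neg]; congr 1; ring
        _ ≤ (s / (n + 1) + 1)⁻¹ := by
            gcongr; exact Real.add_one_le_exp _
        _ = _ := by field_simp; ring_nf
    rw [risingBinom_succ, div_le_div_iff₀ (by positivity) (by positivity)]
    push_cast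
    rw [e1]
    have := mul_le_mul_of_nonneg_left e2 (show 0 ≤ risingBinom n s * (n + 1 : ℝ) ^ s *
      ((s + n + 1) / (n + 1)) from by have := risingBinom_pos hs n; positivity)
    have h3 : (s + n + 1) / (n + 1) * ((n + 1) / (s + n + 1)) = 1 := by field_simp
    calc _ = risingBinom n s * (n + 1 : ℝ) ^ s * ((s + n + 1) / (n + 1)) *
          (1 - 1 / (n + 1)) ^ s := by ring
      _ ≤ _ := this
      _ = _ := by rw [mul_assoc, h3, mul_one]

/-- Euler's limit formula for the Gamma function. -/
lemma tendsto_risingBinom_div_rpow {s : ℝ} (hs : 0 < s) :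
    Tendsto (fun n : ℕ => risingBinom n s / (n : ℝ) ^ s) atTop (𝓝 (1 / Real.Gamma (s + 1))) := by
  have h := ((Real.GammaSeq_tendsto_Gamma s).const_mul s).inv₀
    (mul_pos hs (Real.Gamma_pos_of_pos hs)).ne'
  rw [Real.Gamma_add_one hs.ne', one_div]
  refine h.congr fun n => ?_
  rw [Real.GammaSeq, prod_range_succ', risingBinom, prod_div_distrib]
  have : ∏ i ∈ range n, ((i : ℝ) + 1) = n.factorial := by
    rw [← prod_range_add_one_eq_factorial]; push_cast; rfl
  rw [this]
  have : ∏ i ∈ range n, (s + (i : ℝ) + 1) ≠ 0 := (prod_pos fun i _ => by positivity).ne'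
  push_cast
  simp only [← add_assoc, add_zero]
  field_simp

/-! ### The derivative of the Mittag-Leffler function on the left half-plane -/

/-- The derivative of `E_α`, as the termwise differentiated power series. -/
noncomputable def mittagLefflerDeriv (α : ℝ) (z : ℂ) : ℂ :=
  ∑' k : ℕ, (k + 1 : ℂ) * ((1 / Real.Gamma (α * (k + 1) + 1) : ℝ) : ℂ) * z ^ k

/-- `exists_hasSum_risingBinom` with `z` replaced by `z / n ^ α`, so that the disc of convergence
exhausts the plane as `n → ∞`. -/
lemma exists_hasSum_risingBinom_div_rpow {α : ℝ} (h0 : 0 ≤ α) (h1 : α ≤ 1) {n : ℕ} (hn : 1 ≤ n) :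
    ∃ F : ℂ → ℂ,
      (∀ z : ℂ, ‖z‖ < (n : ℝ) ^ α → HasSum
        (fun k : ℕ => (k + 1 : ℂ) *
          ((risingBinom n (α * (k + 1)) / (n : ℝ) ^ (α * (k + 1)) : ℝ) : ℂ) * z ^ k) (F z)) ∧
      ∀ z w : ℂ, z.re ≤ 0 → w.re ≤ 0 →
        ‖F z - F w‖ ≤ 2 * (risingBinom n (α * 2) / (n : ℝ) ^ (α * 2)) * ‖z - w‖ := by
  obtain ⟨F, hF, hL⟩ := exists_hasSum_risingBinom h0 h1 n
  have hn0 : (0 : ℝ) < n := by exact_mod_cast hn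
  set u : ℝ := (n : ℝ) ^ α
  have hu0 : 0 < u := by positivity
  have hpow : ∀ k : ℕ, (n : ℝ) ^ (α * k) = u ^ k := fun k => by
    rw [Real.rpow_mul hn0.le, Real.rpow_natCast]
  refine ⟨fun z => ((u⁻¹ : ℝ) : ℂ) * F (((u⁻¹ : ℝ) : ℂ) * z), fun z hz => ?_, fun z w hz hw => ?_⟩
  · have hz' : ‖((u⁻¹ : ℝ) : ℂ) * z‖ < 1 := by
      rw [norm_mul, Complex.norm_of_nonneg (by positivity), inv_mul_lt_iff₀ hu0]; simpa
    refine HasSum.congr_fun ((hF _ hz').mul_left ((u⁻¹ : ℝ) : ℂ)) fun k => ?_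
    have hk := hpow (k + 1)
    push_cast at hk
    have hu' : (u : ℂ) ≠ 0 := by exact_mod_cast hu0.ne'
    rw [hk]
    push_cast
    rw [mul_pow, inv_pow]
    field_simp
    ring
  · rw [← mul_sub, norm_mul, Complex.norm_of_nonneg (by positivity)]
    have := hL (((u⁻¹ : ℝ) : ℂ) * z) (((u⁻¹ : ℝ) : ℂ) * w)
      (by rw [Complex.re_ofReal_mul]; exact mul_nonpos_of_nonneg_of_nonpos (by positivity) hz)
      (by rw [Complex.re_ofReal_mul]; exact mul_nonpos_of_nonneg_of_nonpos (by positivity) hw)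
    rw [← mul_sub, norm_mul, Complex.norm_of_nonneg (by positivity)] at this
    refine (mul_le_mul_of_nonneg_left this (by positivity)).trans_eq ?_
    have h2 := hpow 2
    push_cast at h2
    rw [h2]; field_simp

lemma exists_one_le_lt_rpow {α : ℝ} (h0 : 0 < α) (r : ℝ) : ∃ n : ℕ, 1 ≤ n ∧ r < (n : ℝ) ^ α :=
  (((tendsto_rpow_atTop h0).comp tendsto_natCast_atTop_atTop).eventually_gt_atTop r
    |>.and (eventually_ge_atTop 1)).exists.imp fun _ h => ⟨h.2, h.1⟩

lemma summable_risingBinom_div_rpow {α : ℝ} (h0 : 0 ≤ α) (h1 : α ≤ 1) {n : ℕ} (hn : 1 ≤ n)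
    {r : ℝ} (hr0 : 0 ≤ r) (hr : r < (n : ℝ) ^ α) :
    Summable fun k : ℕ => (k + 1 : ℝ) *
      (risingBinom n (α * (k + 1)) / (n : ℝ) ^ (α * (k + 1))) * r ^ k := by
  obtain ⟨F, hF, -⟩ := exists_hasSum_risingBinom_div_rpow h0 h1 hn
  have := (hF r (by rwa [Complex.norm_of_nonneg hr0])).summable
  rw [← Complex.summable_ofReal]
  refine this.congr fun k => ?_
  push_cast; rfl

lemma one_div_Gamma_le {s : ℝ} (hs : 0 < s) {n : ℕ} (hn : 1 ≤ n) :
    1 / Real.Gamma (s + 1) ≤ risingBinom n s / (n : ℝ) ^ s :=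
  le_of_tendsto (tendsto_risingBinom_div_rpow hs) <| (eventually_ge_atTop n).mono fun _ hm =>
    risingBinom_div_rpow_antitone hs.le hn hm

lemma summable_mittagLefflerDeriv {α : ℝ} (h0 : 0 < α) (h1 : α ≤ 1) {r : ℝ} (hr : 0 ≤ r) :
    Summable fun k : ℕ => (k + 1 : ℝ) * (1 / Real.Gamma (α * (k + 1) + 1)) * r ^ k := by
  obtain ⟨n, hn, hrn⟩ := exists_one_le_lt_rpow h0 r
  refine Summable.of_nonneg_of_le (fun k => ?_) (fun k => ?_)
    (summable_risingBinom_div_rpow h0.le h1 hn hr hrn)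
  · have := Real.Gamma_pos_of_pos (show 0 < α * (k + 1) + 1 by positivity)
    positivity
  · refine mul_le_mul_of_nonneg_right (mul_le_mul_of_nonneg_left ?_ (by positivity))
      (by positivity)
    exact one_div_Gamma_le (by positivity) hn

/-- `E_α'` is Lipschitz on the closed left half-plane, with constant `E_α''(0)`: the bound passes to
the limit from the approximations. -/
lemma norm_mittagLefflerDeriv_sub_le {α : ℝ} (h0 : 0 < α) (h1 : α ≤ 1) {z w : ℂ}
    (hz : z.re ≤ 0) (hw : w.re ≤ 0) :
    ‖mittagLefflerDeriv α z - mittagLefflerDeriv α w‖ ≤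
      2 / Real.Gamma (α * 2 + 1) * ‖z - w‖ := by
  choose F hF hL using fun n : ℕ =>
    exists_hasSum_risingBinom_div_rpow h0.le h1 (Nat.le_add_left 1 n)
  have key : ∀ u : ℂ, Tendsto (fun n => F n u) atTop (𝓝 (mittagLefflerDeriv α u)) := by
    intro u
    obtain ⟨m, hm, hum⟩ := exists_one_le_lt_rpow h0 ‖u‖
    have := tendsto_tsum_of_dominated_convergence (𝓕 := atTop)
      (f := fun (n : ℕ) (k : ℕ) => (k + 1 : ℂ) *
        ((risingBinom (n + 1) (α * (k + 1)) / ((n + 1 : ℕ) : ℝ) ^ (α * (k + 1)) : ℝ) : ℂ) * u ^ k)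
      (g := fun k : ℕ => (k + 1 : ℂ) * ((1 / Real.Gamma (α * (k + 1) + 1) : ℝ) : ℂ) * u ^ k)
      (summable_risingBinom_div_rpow h0.le h1 hm (norm_nonneg u) hum) (fun k => ?_) ?_
    · refine this.congr' ((eventually_ge_atTop m).mono fun n hn => (hF n u ?_).tsum_eq)
      refine hum.trans_le (Real.rpow_le_rpow (by positivity) ?_ h0.le)
      exact_mod_cast hn.trans (Nat.le_succ n)
    · refine (((Complex.continuous_ofReal.tendsto _).comp ?_).const_mul _).mul_const _
      exact (tendsto_risingBinom_div_rpow (s := α * (k + 1)) (by positivity)).comp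
        (tendsto_add_atTop_nat 1)
    · refine (eventually_ge_atTop m).mono fun n hn k => ?_
      have hp := risingBinom_pos (show 0 ≤ α * (k + 1 : ℝ) by positivity) (n + 1)
      have hk : ‖(k + 1 : ℂ)‖ = k + 1 := by exact_mod_cast Complex.norm_natCast (k + 1)
      rw [norm_mul, norm_mul, norm_pow, hk, Complex.norm_of_nonneg (by positivity)]
      refine mul_le_mul_of_nonneg_right (mul_le_mul_of_nonneg_left ?_ (by positivity))
        (by positivity)
      exact risingBinom_div_rpow_antitone (by positivity) hm (hn.trans (Nat.le_succ n))
  refine le_of_tendsto_of_tendsto ((key z).sub (key w)).norm ?_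
    (Eventually.of_forall fun n => hL n z w hz hw)
  have := ((tendsto_risingBinom_div_rpow (s := α * 2) (by positivity)).comp
        (tendsto_add_atTop_nat 1))
  rw [← mul_one_div]
  exact (this.const_mul 2).mul_const _

lemma hasDerivAt_mittagLeffler {α : ℝ} (h0 : 0 < α) (h1 : α ≤ 1) (z : ℂ) :
    HasDerivAt (mittagLeffler α) (mittagLefflerDeriv α z) z := by
  set R : ℝ := ‖z‖ + 1
  have hR : 0 ≤ R := by positivity
  have hG : ∀ k : ℕ, 0 < Real.Gamma (α * k + 1) := fun k =>
    Real.Gamma_pos_of_pos (by positivity)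
  have h := hasDerivAt_tsum_of_isPreconnected (𝕜 := ℂ) (t := Metric.ball (0 : ℂ) R) (y₀ := 0)
    (y := z) (g := fun (k : ℕ) y => y ^ k / ((Real.Gamma (α * k + 1) : ℝ) : ℂ))
    (g' := fun (k : ℕ) y => k * y ^ (k - 1) / ((Real.Gamma (α * k + 1) : ℝ) : ℂ))
    (u := fun k : ℕ => k * R ^ (k - 1) / Real.Gamma (α * k + 1)) ?_ Metric.isOpen_ball
    (convex_ball _ _).isPreconnected ?_ ?_ (by simp [R]; positivity) ?_ (by simp [R])
  · have hs : Summable fun k : ℕ => (k + 1 : ℂ) *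
        ((1 / Real.Gamma (α * (k + 1) + 1) : ℝ) : ℂ) * z ^ k := by
      refine Summable.of_norm ((summable_mittagLefflerDeriv h0 h1 (norm_nonneg z)).congr
        fun k => ?_)
      have hk : ‖(k + 1 : ℂ)‖ = k + 1 := by exact_mod_cast Complex.norm_natCast (k + 1)
      have := hG (k + 1)
      push_cast at this
      rw [norm_mul, norm_mul, norm_pow, hk, Complex.norm_of_nonneg (by positivity)]
    have e : ∀ k : ℕ, ((k + 1 : ℕ) : ℂ) * z ^ (k + 1 - 1) /
        ((Real.Gamma (α * ((k + 1 : ℕ) : ℝ) + 1) : ℝ) : ℂ) =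
          (k + 1 : ℂ) * ((1 / Real.Gamma (α * (k + 1) + 1) : ℝ) : ℂ) * z ^ k := fun k => by
      push_cast
      ring
    have hs' := (summable_nat_add_iff (f := fun k : ℕ => (k : ℂ) * z ^ (k - 1) /
      ((Real.Gamma (α * k + 1) : ℝ) : ℂ)) 1).mp (hs.congr fun k => (e k).symm)
    rw [hs'.tsum_eq_zero_add, Nat.cast_zero, zero_mul, zero_div, zero_add, tsum_congr e] at h
    exact h
  · rw [← summable_nat_add_iff 1]
    refine (summable_mittagLefflerDeriv h0 h1 hR).congr fun k => ?_
    push_cast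
    ring
  · intro k y _
    exact (hasDerivAt_pow k y).div_const _
  · intro k y hy
    rw [norm_div, norm_mul, norm_pow, Complex.norm_natCast, Complex.norm_of_nonneg (hG k).le]
    have := hG k
    have hy' : ‖y‖ ≤ R := by simpa using (mem_ball_zero_iff.mp hy).le
    gcongr
  · refine summable_of_ne_finset_zero (s := {0}) fun k hk => ?_
    rw [zero_pow (by simpa using hk), zero_div]

/-! ### The weighted sum of the coefficients `b_{jn}` -/

/-- The weight `1 / (s ^ (1 - α) (t - s) ^ α)`, whose integrals over `[j - 1, j]` for `t = n` are
the coefficients `b_{jn}`. -/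
noncomputable def betaWeight (α t s : ℝ) : ℝ := 1 / (s ^ (1 - α) * (t - s) ^ α)

lemma betaWeight_nonneg {α t s : ℝ} (h0 : 0 ≤ s) (h1 : s ≤ t) : 0 ≤ betaWeight α t s := by
  have : 0 ≤ t - s := sub_nonneg.mpr h1
  unfold betaWeight; positivity

lemma betaWeight_eq {α t s : ℝ} (h0 : 0 ≤ s) (h1 : s ≤ t) :
    betaWeight α t s = s ^ (α - 1) * (t - s) ^ (-α) := by
  rw [betaWeight, one_div, mul_inv, ← Real.rpow_neg h0, ← Real.rpow_neg (sub_nonneg.mpr h1),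
    neg_sub]

lemma intervalIntegrable_betaWeight {α t : ℝ} (hα : α ∈ Set.Ioo (0 : ℝ) 1) (ht : 0 < t) :
    IntervalIntegrable (betaWeight α t) volume 0 t := by
  obtain ⟨h0, h1⟩ := hα
  have e : Set.EqOn (fun s => s ^ (α - 1) * (t - s) ^ (-α)) (betaWeight α t) (Set.Ioo 0 t) :=
    fun s hs => (betaWeight_eq hs.1.le hs.2.le).symm
  refine IntervalIntegrable.trans (b := t / 2) ?_ ?_
  · refine IntervalIntegrable.congr_uIoo (f := fun s => s ^ (α - 1) * (t - s) ^ (-α)) ?_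
      (e.mono ?_)
    · refine (intervalIntegral.intervalIntegrable_rpow' (by linarith)).mul_continuousOn ?_
      intro s hs
      rw [Set.uIcc_of_le (by linarith)] at hs
      exact ContinuousAt.continuousWithinAt
        (ContinuousAt.rpow_const (by fun_prop) (Or.inl (by linarith [hs.2])))
    · rw [Set.uIoo_of_le (by linarith)]
      exact Set.Ioo_subset_Ioo_right (by linarith)
  · refine IntervalIntegrable.congr_uIoo (f := fun s => s ^ (α - 1) * (t - s) ^ (-α)) ?_
      (e.mono ?_)
    · refine IntervalIntegrable.continuousOn_mul ?_ ?_
      · have := (intervalIntegral.intervalIntegrable_rpow' (a := t / 2) (b := 0) (r := -α)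
          (by linarith)).comp_sub_left t
        rwa [sub_zero, sub_half] at this
      · intro s hs
        rw [Set.uIcc_of_le (by linarith)] at hs
        exact ContinuousAt.continuousWithinAt
          (ContinuousAt.rpow_const (by fun_prop) (Or.inl (by linarith [hs.1])))
    · rw [Set.uIoo_of_le (by linarith)]
      exact Set.Ioo_subset_Ioo_left (by linarith)

lemma intervalIntegrable_betaWeight_cell {α : ℝ} (hα : α ∈ Set.Ioo (0 : ℝ) 1) {k n : ℕ}
    (hk : k < n) : IntervalIntegrable (betaWeight α n) volume k ((k + 1 : ℕ) : ℝ) := by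
  have hkn : ((k + 1 : ℕ) : ℝ) ≤ n := by exact_mod_cast hk
  have hn : (0 : ℝ) < n := by exact_mod_cast (Nat.zero_le k).trans_lt hk
  refine (intervalIntegrable_betaWeight hα hn).mono_set ?_
  rw [Set.uIcc_of_le (by simp), Set.uIcc_of_le hn.le]
  exact Set.Icc_subset_Icc (by positivity) hkn

lemma coeffB_succ (α : ℝ) (k n : ℕ) :
    coeffB α (k + 1) n = ∫ x in (k : ℝ)..((k + 1 : ℕ) : ℝ), betaWeight α n x := by
  simp [coeffB, betaWeight]

lemma coeffB_succ_nonneg {α : ℝ} {k n : ℕ} (hk : k < n) : 0 ≤ coeffB α (k + 1) n := by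
  have hkn : ((k + 1 : ℕ) : ℝ) ≤ n := by exact_mod_cast hk
  rw [coeffB_succ]
  exact intervalIntegral.integral_nonneg (by simp) fun x hx =>
    betaWeight_nonneg ((Nat.cast_nonneg k).trans hx.1) (hx.2.trans hkn)

/-- The integrals of the weight are invariant under dilations. -/
lemma integral_betaWeight_mul (α : ℝ) {a b t c : ℝ} (ha : 0 ≤ a) (hab : a ≤ b) (hb : b ≤ t)
    (hc : 0 < c) :
    ∫ s in (a * c)..(b * c), betaWeight α (t * c) s = ∫ x in a..b, betaWeight α t x := by
  have h := intervalIntegral.integral_comp_mul_right (a := a) (b := b)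
    (betaWeight α (t * c)) hc.ne'
  rw [smul_eq_mul] at h
  rw [← mul_right_inj' (inv_ne_zero hc.ne'), ← h, ← intervalIntegral.integral_const_mul]
  refine intervalIntegral.integral_congr_uIoo fun x hx => ?_
  rw [Set.uIoo_of_le hab] at hx
  have hx0 : 0 ≤ x := ha.trans hx.1.le
  have hx1 : 0 ≤ t - x := by linarith [hx.2]
  have e : c ^ (1 - α) * c ^ α = c := by
    rw [← Real.rpow_add hc, sub_add_cancel, Real.rpow_one]
  simp only [betaWeight]
  rw [← sub_mul, Real.mul_rpow hx0 hc.le, Real.mul_rpow hx1 hc.le, mul_mul_mul_comm, e, one_div,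
    one_div, mul_inv, mul_comm]

lemma coeffB_succ_eq_integral (α : ℝ) {k n : ℕ} (hk : k < n) {dt : ℝ} (hdt : 0 < dt) :
    coeffB α (k + 1) n =
      ∫ s in node dt k..node dt (k + 1), betaWeight α (node dt n) s := by
  rw [coeffB_succ]
  exact (integral_betaWeight_mul α (Nat.cast_nonneg k) (by simp) (by exact_mod_cast hk) hdt).symm

lemma sum_coeffB {α : ℝ} (hα : α ∈ Set.Ioo (0 : ℝ) 1) {n : ℕ} (hn : 1 ≤ n) :
    ∑ k ∈ range n, coeffB α (k + 1) n = ∫ x in (0 : ℝ)..1, betaWeight α 1 x := by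
  have hn0 : (0 : ℝ) < n := by exact_mod_cast hn
  simp_rw [coeffB_succ]
  rw [intervalIntegral.sum_integral_adjacent_intervals (a := fun k : ℕ => (k : ℝ))
    fun k hk => intervalIntegrable_betaWeight_cell hα hk, Nat.cast_zero,
    ← integral_betaWeight_mul α le_rfl zero_le_one le_rfl hn0, zero_mul, one_mul]

/-- Bernoulli's inequality, as a bound for the increments of a concave power. -/
lemma mul_rpow_le_succ_rpow_sub {p : ℝ} (h0 : 0 ≤ p) (h1 : p ≤ 1) (k : ℕ) :
    p * (k + 1 : ℝ) ^ (p - 1) ≤ (k + 1 : ℝ) ^ p - (k : ℝ) ^ p := by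
  have hk : (0 : ℝ) < k + 1 := by positivity
  have hs : -1 ≤ -(1 / (k + 1 : ℝ)) := by
    rw [neg_le_neg_iff, div_le_one hk]; linarith [(Nat.cast_nonneg k : (0 : ℝ) ≤ k)]
  have h := rpow_one_add_le_one_add_mul_self hs h0 h1
  have e : (k : ℝ) ^ p = (k + 1 : ℝ) ^ p * (1 + -(1 / (k + 1 : ℝ))) ^ p := by
    rw [← Real.mul_rpow hk.le (by linarith)]; congr 1; field_simp; ring
  have e2 : (k + 1 : ℝ) ^ (p - 1) = (k + 1 : ℝ) ^ p * (1 / (k + 1)) := by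
    rw [Real.rpow_sub_one hk.ne', mul_one_div]
  rw [e, e2]
  nlinarith [mul_le_mul_of_nonneg_left h (Real.rpow_nonneg hk.le p)]

lemma succ_rpow_sub_le {α : ℝ} (h1 : α ≤ 1) (k : ℕ) :
    (k + 1 : ℝ) ^ α - (k : ℝ) ^ α ≤ (k + 1 : ℝ) ^ (α - 1) := by
  have hk : (0 : ℝ) < k + 1 := by positivity
  have h : (k : ℝ) / (k + 1) ≤ ((k : ℝ) / (k + 1)) ^ α := by
    refine Real.self_le_rpow_of_le_one (by positivity) ?_ h1
    rw [div_le_one hk]; linarith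
  rw [Real.div_rpow (by positivity) hk.le, div_le_div_iff₀ hk (by positivity)] at h
  rw [Real.rpow_sub_one hk.ne', le_div_iff₀ hk]
  linarith

/-- The cells in the left half of `[0, n]`, where `n - x ≥ n / 2`. -/
lemma coeffB_succ_le {α : ℝ} (hα : α ∈ Set.Ioo (0 : ℝ) 1) {k n : ℕ} (hk : 2 * (k + 1) ≤ n) :
    coeffB α (k + 1) n ≤ ((n : ℝ) / 2) ^ (-α) / α * (k + 1 : ℝ) ^ (α - 1) := by
  obtain ⟨h0, h1⟩ := hα
  have hkn : 2 * (k + 1 : ℝ) ≤ n := by exact_mod_cast hk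
  have hn : (0 : ℝ) < n := by have : (0 : ℝ) ≤ k := Nat.cast_nonneg k; linarith
  calc coeffB α (k + 1) n
      ≤ ∫ x in (k : ℝ)..((k + 1 : ℕ) : ℝ), ((n : ℝ) / 2) ^ (-α) * x ^ (α - 1) := by
        rw [coeffB_succ]
        refine intervalIntegral.integral_mono_on_of_le_Ioo (by simp)
          (intervalIntegrable_betaWeight_cell ⟨h0, h1⟩ (by omega))
          ((intervalIntegral.intervalIntegrable_rpow' (by linarith)).const_mul _) fun x hx => ?_
        have hx0 : 0 ≤ x := (Nat.cast_nonneg k).trans hx.1.le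
        have hx1 : x ≤ k + 1 := by have := hx.2.le; push_cast at this; exact this
        rw [betaWeight_eq hx0 (by linarith), mul_comm]
        refine mul_le_mul_of_nonneg_right ?_ (by positivity)
        exact Real.rpow_le_rpow_of_nonpos (by positivity) (by linarith) (by linarith)
    _ = ((n : ℝ) / 2) ^ (-α) / α * ((k + 1 : ℝ) ^ α - (k : ℝ) ^ α) := by
        rw [intervalIntegral.integral_const_mul, integral_rpow (Or.inl (by linarith)),
          sub_add_cancel]
        push_cast; ring
    _ ≤ _ := mul_le_mul_of_nonneg_left (succ_rpow_sub_le h1.le k) (by positivity)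

lemma sum_succ_rpow_sub_mul_coeffB_le {α : ℝ} (hα : α ∈ Set.Ioo (0 : ℝ) 1) {n : ℕ} (hn : 1 ≤ n) :
    ∑ k ∈ range n, ((k + 1 : ℝ) ^ α - (k : ℝ) ^ α) * coeffB α (k + 1) n ≤
      2 ^ α / α * ((n : ℝ) ^ (-α) * ∑ k ∈ range n, (k + 1 : ℝ) ^ (2 * α - 2)) +
        2 ^ (1 - α) * (∫ x in (0 : ℝ)..1, betaWeight α 1 x) * (n : ℝ) ^ (-1 + α) := by
  have h0 := hα.1
  have h1 := hα.2
  have hn0 : (0 : ℝ) < n := by exact_mod_cast hn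
  have e1 : 2 ^ α / α * (n : ℝ) ^ (-α) = ((n : ℝ) / 2) ^ (-α) / α := by
    rw [Real.div_rpow hn0.le (by norm_num), Real.rpow_neg (by norm_num : (0 : ℝ) ≤ 2)]
    field_simp
  have e2 : 2 ^ (1 - α) * (n : ℝ) ^ (-1 + α) = ((n : ℝ) / 2) ^ (α - 1) := by
    rw [Real.div_rpow hn0.le (by norm_num), ← neg_sub 1 α,
      Real.rpow_neg (by norm_num : (0 : ℝ) ≤ 2), neg_sub, neg_add_eq_sub]
    field_simp
  rw [← mul_assoc, e1, mul_right_comm, e2, ← sum_coeffB hα hn, mul_sum, mul_sum,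
    ← sum_add_distrib]
  refine sum_le_sum fun k hk => ?_
  have hb := coeffB_succ_nonneg (α := α) (mem_range.mp hk)
  have hd := succ_rpow_sub_le h1.le k
  have hk0 : (0 : ℝ) < k + 1 := by positivity
  by_cases hkn : 2 * (k + 1) ≤ n
  · refine le_trans ?_ (le_add_of_nonneg_right (by positivity))
    refine (mul_le_mul hd (coeffB_succ_le hα hkn) hb (by positivity)).trans_eq ?_
    rw [show 2 * α - 2 = (α - 1) + (α - 1) by ring, Real.rpow_add hk0]
    ring
  · refine le_trans ?_ (le_add_of_nonneg_left (by positivity))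
    refine mul_le_mul_of_nonneg_right (hd.trans ?_) hb
    have : (n : ℝ) ≤ 2 * (k + 1) := by exact_mod_cast (not_le.mp hkn).le
    exact Real.rpow_le_rpow_of_nonpos (by positivity) (by linarith) (by linarith)

lemma exists_rpow_le_eta (α : ℝ) :
    ∃ C : ℝ, 0 < C ∧ ∀ n : ℕ, 1 ≤ n → (n : ℝ) ^ (-1 + α) ≤ C * eta α n := by
  rcases lt_trichotomy α (1 / 2) with h | h | h
  · refine ⟨1, one_pos, fun n hn => ?_⟩
    rw [eta, if_pos h, one_mul]
    exact Real.rpow_le_rpow_of_exponent_le (by exact_mod_cast hn) (by linarith)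
  · have hl : 0 < Real.log 2 := Real.log_pos one_lt_two
    refine ⟨(Real.log 2)⁻¹, inv_pos.mpr hl, fun n hn => ?_⟩
    have hn' : (1 : ℝ) ≤ n := by exact_mod_cast hn
    rw [eta, if_neg h.not_lt, if_pos h, h, show (-1 + 1 / 2 : ℝ) = -(1 / 2) by norm_num,
      mul_left_comm]
    refine le_mul_of_one_le_right (by positivity) ?_
    rw [← div_eq_inv_mul, one_le_div hl]
    exact Real.log_le_log two_pos (by linarith)
  · refine ⟨1, one_pos, fun n hn => ?_⟩
    rw [eta, if_neg h.not_gt, if_neg h.ne', one_mul]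

lemma exists_rpow_mul_sum_le_eta {α : ℝ} (h1 : α < 1) :
    ∃ C : ℝ, 0 < C ∧ ∀ n : ℕ, 1 ≤ n →
      (n : ℝ) ^ (-α) * ∑ k ∈ range n, (k + 1 : ℝ) ^ (2 * α - 2) ≤ C * eta α n := by
  rcases lt_trichotomy α (1 / 2) with h | h | h
  · have hs : Summable fun k : ℕ => (k + 1 : ℝ) ^ (2 * α - 2) := by
      have := (summable_nat_add_iff 1).mpr
        (Real.summable_nat_rpow.mpr (show 2 * α - 2 < -1 by linarith))
      exact_mod_cast this
    have hpos : ∀ k : ℕ, 0 < (k + 1 : ℝ) ^ (2 * α - 2) := fun k => by positivity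
    refine ⟨∑' k : ℕ, (k + 1 : ℝ) ^ (2 * α - 2), hs.tsum_pos (fun k => (hpos k).le) 0 (hpos 0),
      fun n hn => ?_⟩
    rw [eta, if_pos h, mul_comm]
    exact mul_le_mul_of_nonneg_right (hs.sum_le_tsum _ fun k _ => (hpos k).le) (by positivity)
  · have hl : 0 < Real.log 2 := Real.log_pos one_lt_two
    refine ⟨(Real.log 2)⁻¹ + 1, by positivity, fun n hn => ?_⟩
    have hn' : (1 : ℝ) ≤ n := by exact_mod_cast hn
    rw [eta, if_neg h.not_lt, if_pos h, h, mul_left_comm]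
    refine mul_le_mul_of_nonneg_left ?_ (by positivity)
    have hh := harmonic_le_one_add_log n
    have e : ∑ k ∈ range n, (k + 1 : ℝ) ^ (2 * (1 / 2) - 2 : ℝ) = harmonic n := by
      rw [harmonic]; push_cast
      refine sum_congr rfl fun k _ => ?_
      rw [show (2 * (1 / 2) - 2 : ℝ) = -1 by norm_num, Real.rpow_neg_one]
    rw [e, add_mul, one_mul]
    refine hh.trans (add_le_add ?_ (Real.log_le_log (by linarith) (by linarith)))
    rw [← div_eq_inv_mul, one_le_div hl]
    exact Real.log_le_log two_pos (by linarith)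
  · have hp : 0 < 2 * α - 1 := by linarith
    refine ⟨(2 * α - 1)⁻¹, inv_pos.mpr hp, fun n hn => ?_⟩
    have hn0 : (0 : ℝ) < n := by exact_mod_cast hn
    rw [eta, if_neg h.not_gt, if_neg h.ne', show -1 + α = -α + (2 * α - 1) by ring,
      Real.rpow_add hn0, mul_left_comm]
    refine mul_le_mul_of_nonneg_left ?_ (by positivity)
    rw [← div_eq_inv_mul, le_div_iff₀ hp, mul_comm, mul_sum]
    calc ∑ k ∈ range n, (2 * α - 1) * (k + 1 : ℝ) ^ (2 * α - 2)
        ≤ ∑ k ∈ range n, (((k + 1 : ℕ) : ℝ) ^ (2 * α - 1) - (k : ℝ) ^ (2 * α - 1)) := by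
          refine sum_le_sum fun k _ => ?_
          have := mul_rpow_le_succ_rpow_sub hp.le (by linarith) k
          rw [show 2 * α - 1 - 1 = 2 * α - 2 by ring] at this
          exact_mod_cast this
      _ = (n : ℝ) ^ (2 * α - 1) := by
          rw [sum_range_sub (fun k : ℕ => (k : ℝ) ^ (2 * α - 1)), Nat.cast_zero,
            Real.zero_rpow hp.ne', sub_zero]

lemma exists_sum_succ_rpow_sub_mul_coeffB_le_eta {α : ℝ} (hα : α ∈ Set.Ioo (0 : ℝ) 1) :
    ∃ C : ℝ, 0 < C ∧ ∀ n : ℕ, 1 ≤ n →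
      ∑ k ∈ range n, ((k + 1 : ℝ) ^ α - (k : ℝ) ^ α) * coeffB α (k + 1) n ≤ C * eta α n := by
  obtain ⟨C₁, hC₁, h₁⟩ := exists_rpow_le_eta α
  obtain ⟨C₂, hC₂, h₂⟩ := exists_rpow_mul_sum_le_eta hα.2
  have hα0 := hα.1
  have hB : 0 ≤ ∫ x in (0 : ℝ)..1, betaWeight α 1 x :=
    intervalIntegral.integral_nonneg zero_le_one fun x hx => betaWeight_nonneg hx.1 hx.2
  refine ⟨2 ^ α / α * C₂ + 2 ^ (1 - α) * (∫ x in (0 : ℝ)..1, betaWeight α 1 x) * C₁,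
    by positivity, fun n hn => (sum_succ_rpow_sub_mul_coeffB_le hα hn).trans ?_⟩
  rw [add_mul, mul_assoc (2 ^ α / α), mul_assoc _ C₁]
  exact add_le_add (mul_le_mul_of_nonneg_left (h₂ n hn) (by positivity))
    (mul_le_mul_of_nonneg_left (h₁ n hn) (by positivity))

/-! ### The error of the scheme -/

lemma re_nonneg_of_mem_closure_sector {φ : ℝ} (hφ : φ ≤ Real.pi / 2) {z : ℂ}
    (hz : z ∈ closure (sector φ)) : 0 ≤ z.re :=
  closure_minimal (fun _ hw => Complex.abs_arg_le_pi_div_two_iff.mp (hw.2.le.trans hφ))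
    (isClosed_le continuous_const Complex.continuous_re) hz

lemma hasDerivAt_mlSolution {α : ℝ} (h0 : 0 < α) (h1 : α ≤ 1) (lam : ℂ) {s : ℝ} (hs : 0 < s) :
    HasDerivAt (mlSolution α lam)
      (mittagLefflerDeriv α (lam * ((s ^ α : ℝ) : ℂ)) *
        (lam * ((α * s ^ (α - 1) : ℝ) : ℂ))) s :=
  (hasDerivAt_mittagLeffler h0 h1 _).comp s
    ((Real.hasDerivAt_rpow_const (Or.inl hs.ne')).ofReal_comp.const_mul lam)

lemma rlIntegrand_deriv_mlSolution {α : ℝ} (h0 : 0 < α) (h1 : α ≤ 1) (lam : ℂ) {t s : ℝ}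
    (hs : 0 < s) (hst : s ≤ t) :
    rlIntegrand (1 - α) (deriv (mlSolution α lam)) t s =
      (betaWeight α t s : ℂ) * (α * (lam * mittagLefflerDeriv α (lam * ((s ^ α : ℝ) : ℂ)))) := by
  rw [rlIntegrand, (hasDerivAt_mlSolution h0 h1 lam hs).deriv, sub_sub_cancel,
    betaWeight_eq hs.le hst, Real.rpow_neg (sub_nonneg.mpr hst)]
  push_cast
  ring

lemma continuous_mittagLefflerDeriv_comp_rpow {α : ℝ} (h0 : 0 < α) (h1 : α ≤ 1) (lam : ℂ) :
    Continuous fun s : ℝ => mittagLefflerDeriv α (lam * ((s ^ α : ℝ) : ℂ)) := by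
  have hE : Differentiable ℂ (mittagLeffler α) := fun z =>
    (hasDerivAt_mittagLeffler h0 h1 z).differentiableAt
  have hd : deriv (mittagLeffler α) = mittagLefflerDeriv α :=
    funext fun z => (hasDerivAt_mittagLeffler h0 h1 z).deriv
  have hc : Continuous (mittagLefflerDeriv α) := by
    rw [← hd]
    exact (hE.contDiff (n := 1)).continuous_deriv le_rfl
  exact hc.comp (continuous_const.mul
    (Complex.continuous_ofReal.comp (Real.continuous_rpow_const h0.le)))

lemma intervalIntegrable_rlIntegrand_deriv_mlSolution {α : ℝ} (hα : α ∈ Set.Ioo (0 : ℝ) 1)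
    (lam : ℂ) {t : ℝ} (ht : 0 < t) :
    IntervalIntegrable (rlIntegrand (1 - α) (deriv (mlSolution α lam)) t) volume 0 t := by
  refine IntervalIntegrable.congr_uIoo (f := fun s => (betaWeight α t s : ℂ) *
    (α * (lam * mittagLefflerDeriv α (lam * ((s ^ α : ℝ) : ℂ))))) ?_ fun s hs => ?_
  · have hw : IntervalIntegrable (fun s => (betaWeight α t s : ℂ)) volume 0 t :=
      ⟨(intervalIntegrable_betaWeight hα ht).1.ofReal, (intervalIntegrable_betaWeight hα ht).2.ofReal⟩
    exact hw.mul_continuousOn (continuous_const.mul (continuous_const.mul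
      (continuous_mittagLefflerDeriv_comp_rpow hα.1 hα.2.le lam))).continuousOn
  · rw [Set.uIoo_of_le ht.le] at hs
    exact (rlIntegrand_deriv_mlSolution hα.1 hα.2.le lam hs.1 hs.2.le).symm

/-- The difference quotient of `r ↦ E_α(λ r)` over `[a, b]` differs from the derivative at any
point of `[a, b]` by at most a multiple of `b - a`, because `E_α'` is Lipschitz on the left
half-plane. -/
lemma norm_slope_sub_mittagLefflerDeriv_le {α : ℝ} (h0 : 0 < α) (h1 : α ≤ 1) {lam : ℂ}
    (hlam : lam.re ≤ 0) {a b r : ℝ} (ha : 0 ≤ a) (hab : a < b) (hr : r ∈ Set.Icc a b) :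
    ‖lam * mittagLefflerDeriv α (lam * r) -
        (mittagLeffler α (lam * b) - mittagLeffler α (lam * a)) / ((b - a : ℝ) : ℂ)‖ ≤
      2 / Real.Gamma (α * 2 + 1) * ‖lam‖ ^ 2 * (b - a) := by
  have hba : 0 < b - a := sub_pos.mpr hab
  have hG : 0 < Real.Gamma (α * 2 + 1) := Real.Gamma_pos_of_pos (by positivity)
  have hre : ∀ y ∈ Set.Icc a b, (lam * (y : ℂ)).re ≤ 0 := fun y hy => by
    rw [Complex.re_mul_ofReal]
    exact mul_nonpos_of_nonpos_of_nonneg hlam (ha.trans hy.1)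
  have key := Convex.norm_image_sub_le_of_norm_hasDerivWithin_le (𝕜 := ℝ)
    (f := fun y : ℝ => mittagLeffler α (lam * y) - lam * mittagLefflerDeriv α (lam * r) * y)
    (f' := fun y : ℝ => mittagLefflerDeriv α (lam * y) * lam -
      lam * mittagLefflerDeriv α (lam * r))
    (C := 2 / Real.Gamma (α * 2 + 1) * ‖lam‖ ^ 2 * (b - a)) (fun y _ => ?_) (fun y hy => ?_)
    (convex_Icc a b) (Set.left_mem_Icc.mpr hab.le) (Set.right_mem_Icc.mpr hab.le)
  · have hba' : ((b - a : ℝ) : ℂ) ≠ 0 := by exact_mod_cast hba.ne'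
    have e : lam * mittagLefflerDeriv α (lam * r) -
        (mittagLeffler α (lam * b) - mittagLeffler α (lam * a)) / ((b - a : ℝ) : ℂ) =
      -((mittagLeffler α (lam * b) - lam * mittagLefflerDeriv α (lam * r) * b -
        (mittagLeffler α (lam * a) - lam * mittagLefflerDeriv α (lam * r) * a)) /
          ((b - a : ℝ) : ℂ)) := by
      field_simp
      push_cast
      ring
    rw [e, norm_neg, norm_div, Complex.norm_of_nonneg hba.le, div_le_iff₀ hba]
    rwa [Real.norm_of_nonneg hba.le] at key
  · have hid : ∀ c : ℂ, HasDerivAt (fun y : ℝ => c * (y : ℂ)) c y := fun c => by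
      simpa using (Complex.ofRealCLM.hasDerivAt (x := y)).const_mul c
    exact (((hasDerivAt_mittagLeffler h0 h1 _).comp y (hid lam)).sub (hid _)).hasDerivWithinAt
  · rw [mul_comm _ lam, ← mul_sub, norm_mul]
    have h := norm_mittagLefflerDeriv_sub_le h0 h1 (hre y hy) (hre r hr)
    have hyr : ‖lam * (y : ℂ) - lam * r‖ ≤ ‖lam‖ * (b - a) := by
      rw [← mul_sub, norm_mul, ← Complex.ofReal_sub, Complex.norm_real, Real.norm_eq_abs]
      gcongr
      rw [abs_le]
      constructor <;> linarith [hy.1, hy.2, hr.1, hr.2]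
    calc _ ≤ ‖lam‖ * (2 / Real.Gamma (α * 2 + 1) * (‖lam‖ * (b - a))) := by
          gcongr
          exact h.trans (mul_le_mul_of_nonneg_left hyr (by positivity))
      _ = _ := by ring

lemma node_strictMono {dt : ℝ} (hdt : 0 < dt) : StrictMono (node dt) := fun i j hij => by
  have : (i : ℝ) < j := by exact_mod_cast hij
  exact mul_lt_mul_of_pos_right this hdt

lemma node_nonneg {dt : ℝ} (hdt : 0 ≤ dt) (j : ℕ) : 0 ≤ node dt j :=
  mul_nonneg (Nat.cast_nonneg j) hdt

/-- The local error over one cell of the grid. -/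
lemma norm_integral_cell_sub_le {α : ℝ} (hα : α ∈ Set.Ioo (0 : ℝ) 1) {lam : ℂ}
    (hlam : lam.re ≤ 0) {dt : ℝ} (hdt : 0 < dt) {k n : ℕ} (hk : k < n) :
    ‖(∫ s in node dt k..node dt (k + 1),
          rlIntegrand (1 - α) (deriv (mlSolution α lam)) (node dt n) s) -
        α * ((coeffB α (k + 1) n : ℂ) *
          ((mlSolution α lam (node dt (k + 1)) - mlSolution α lam (node dt k)) /
            ((node dt (k + 1) ^ α - node dt k ^ α : ℝ) : ℂ)))‖ ≤
      α * (2 / Real.Gamma (α * 2 + 1)) * ‖lam‖ ^ 2 *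
        (node dt (k + 1) ^ α - node dt k ^ α) * coeffB α (k + 1) n := by
  have h0 := hα.1
  set a := node dt k
  set b := node dt (k + 1)
  set t := node dt n
  have ha : 0 ≤ a := node_nonneg hdt.le k
  have hab : a < b := node_strictMono hdt (Nat.lt_succ_self k)
  have hbt : b ≤ t := (node_strictMono hdt).monotone hk
  have hpow : a ^ α < b ^ α := Real.rpow_lt_rpow ha hab h0
  set q : ℂ := (mlSolution α lam b - mlSolution α lam a) / ((b ^ α - a ^ α : ℝ) : ℂ)
  have ht : 0 < t := ha.trans_lt (hab.trans_le hbt)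
  have hsub : Set.uIcc a b ⊆ Set.uIcc 0 t := by
    rw [Set.uIcc_of_le hab.le, Set.uIcc_of_le ht.le]
    exact Set.Icc_subset_Icc ha hbt
  have hw := (intervalIntegrable_betaWeight hα ht).mono_set hsub
  have hwc : IntervalIntegrable (fun s => (betaWeight α t s : ℂ)) volume a b :=
    ⟨hw.1.ofReal, hw.2.ofReal⟩
  have hv := (intervalIntegrable_rlIntegrand_deriv_mlSolution hα lam ht).mono_set hsub
  have hcb : coeffB α (k + 1) n = ∫ s in a..b, betaWeight α t s :=
    coeffB_succ_eq_integral α hk hdt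
  rw [hcb, ← intervalIntegral.integral_ofReal, mul_left_comm, ← intervalIntegral.integral_mul_const,
    ← intervalIntegral.integral_sub hv (hwc.mul_const _), ← intervalIntegral.integral_const_mul]
  refine intervalIntegral.norm_integral_le_of_norm_le hab.le (ae_of_all _ fun s hs => ?_)
    (hw.const_mul _)
  have hs0 : 0 < s := ha.trans_lt hs.1
  have hw0 := betaWeight_nonneg (α := α) hs0.le (hs.2.trans hbt)
  have hslope := norm_slope_sub_mittagLefflerDeriv_le h0 hα.2.le hlam (Real.rpow_nonneg ha α) hpow
    (r := s ^ α) ⟨Real.rpow_le_rpow ha hs.1.le h0.le, Real.rpow_le_rpow hs0.le hs.2 h0.le⟩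
  rw [rlIntegrand_deriv_mlSolution h0 hα.2.le lam hs0 (hs.2.trans hbt), ← mul_sub, ← mul_sub,
    norm_mul, norm_mul, Complex.norm_of_nonneg hw0, Complex.norm_of_nonneg h0.le]
  calc _ ≤ betaWeight α t s * (α * (2 / Real.Gamma (α * 2 + 1) * ‖lam‖ ^ 2 * (b ^ α - a ^ α))) :=
        mul_le_mul_of_nonneg_left (mul_le_mul_of_nonneg_left hslope h0.le) hw0
    _ = _ := by ring

lemma caputoDeriv_sub_discreteCaputo {α : ℝ} (hα : α ∈ Set.Ioo (0 : ℝ) 1) (lam : ℂ)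
    {dt : ℝ} (hdt : 0 < dt) {n : ℕ} (hn : 1 ≤ n) :
    caputoDeriv α (mlSolution α lam) (node dt n) - discreteCaputo α (mlSolution α lam) dt n =
      1 / ((Real.Gamma (1 - α) : ℝ) : ℂ) * ∑ k ∈ range n,
        ((∫ s in node dt k..node dt (k + 1),
            rlIntegrand (1 - α) (deriv (mlSolution α lam)) (node dt n) s) -
          α * ((coeffB α (k + 1) n : ℂ) *
            ((mlSolution α lam (node dt (k + 1)) - mlSolution α lam (node dt k)) /
              ((node dt (k + 1) ^ α - node dt k ^ α : ℝ) : ℂ)))) := by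
  have hmono := (node_strictMono hdt).monotone
  have ht : 0 < node dt n := mul_pos (by exact_mod_cast hn) hdt
  have hv := intervalIntegrable_rlIntegrand_deriv_mlSolution hα lam ht
  have hsum := intervalIntegral.sum_integral_adjacent_intervals (a := node dt) (n := n)
    (μ := volume) (f := rlIntegrand (1 - α) (deriv (mlSolution α lam)) (node dt n))
    fun k hk => hv.mono_set (by
      rw [Set.uIcc_of_le (hmono k.le_succ), Set.uIcc_of_le ht.le]
      exact Set.Icc_subset_Icc (node_nonneg hdt.le k) (hmono hk))
  rw [show node dt 0 = 0 by simp [node]] at hsum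
  have hIcc : Icc 1 n = Ico (0 + 1) (n + 1) := by ext j; simp only [mem_Icc, mem_Ico]; omega
  rw [sum_sub_distrib, hsum, ← mul_sum, mul_sub, caputoDeriv, rlIntegral, discreteCaputo, hIcc,
    ← sum_Ico_add', ← range_eq_Ico]
  simp only [Nat.add_sub_cancel]
  push_cast
  ring

end FracCaputo


open FracCaputo in
theorem lemma2p3 (α : ℝ) (hα : α ∈ Set.Ioo (0 : ℝ) 1) :
    ∃ C : ℝ, 0 < C ∧
      ∀ φ₀ ∈ Set.Ioo (0 : ℝ) (Real.pi / 2),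
      ∀ lam : ℂ, -lam ∈ closure (FracCaputo.sector φ₀) →
      ∀ T : ℝ, 0 < T → ∀ N n : ℕ, 1 ≤ n → n ≤ N → ∀ dt : ℝ, dt = T / N →
        FracCaputo.CaputoDerivExists α (FracCaputo.mlSolution α lam) (FracCaputo.node dt n) ∧
        ‖FracCaputo.caputoDeriv α (FracCaputo.mlSolution α lam) (FracCaputo.node dt n)
            - FracCaputo.discreteCaputo α (FracCaputo.mlSolution α lam) dt n‖
          ≤ C * FracCaputo.eta α n * ‖lam‖ ^ 2 * dt ^ α * (1 + ‖lam‖ * dt ^ α) := by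
  have h0 := hα.1
  have h1 := hα.2
  obtain ⟨C, hC, hS⟩ := exists_sum_succ_rpow_sub_mul_coeffB_le_eta hα
  have hG : 0 < Real.Gamma (1 - α) := Real.Gamma_pos_of_pos (by linarith)
  have hG2 : 0 < Real.Gamma (α * 2 + 1) := Real.Gamma_pos_of_pos (by linarith)
  set M : ℝ := 1 / Real.Gamma (1 - α) * (α * (2 / Real.Gamma (α * 2 + 1)))
  have hM0 : 0 < M := by positivity
  refine ⟨M * C, by positivity, ?_⟩
  rintro φ hφ lam hmem T hT N n hn hnN dt rfl
  have hN : (0 : ℝ) < N := by exact_mod_cast hn.trans hnN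
  have hdt : 0 < T / N := div_pos hT hN
  set dt := T / N
  have hlam : lam.re ≤ 0 := by
    simpa using re_nonneg_of_mem_closure_sector hφ.2.le hmem
  have ht : 0 < node dt n := mul_pos (by exact_mod_cast hn) hdt
  refine ⟨⟨fun s hs => (hasDerivAt_mlSolution h0 h1.le lam hs.1).differentiableAt,
    intervalIntegrable_rlIntegrand_deriv_mlSolution hα lam ht⟩, ?_⟩
  have hCη : 0 ≤ C * eta α n := (hS n hn).trans' <| Finset.sum_nonneg fun k hk =>
    mul_nonneg (sub_nonneg.mpr (Real.rpow_le_rpow (by positivity) (by linarith) h0.le))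
      (coeffB_succ_nonneg (Finset.mem_range.mp hk))
  have hnode : ∀ k : ℕ, node dt (k + 1) ^ α - node dt k ^ α =
      dt ^ α * ((k + 1 : ℝ) ^ α - (k : ℝ) ^ α) := fun k => by
    rw [node, node, Real.mul_rpow (by positivity) hdt.le, Real.mul_rpow (by positivity) hdt.le]
    push_cast; ring
  rw [caputoDeriv_sub_discreteCaputo hα lam hdt hn, norm_mul, norm_div, norm_one,
    Complex.norm_of_nonneg hG.le]
  calc _ ≤ 1 / Real.Gamma (1 - α) * ∑ k ∈ Finset.range n,
        α * (2 / Real.Gamma (α * 2 + 1)) * ‖lam‖ ^ 2 *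
          (node dt (k + 1) ^ α - node dt k ^ α) * coeffB α (k + 1) n := by
        gcongr
        exact (norm_sum_le _ _).trans (Finset.sum_le_sum fun k hk =>
          norm_integral_cell_sub_le hα hlam hdt (Finset.mem_range.mp hk))
    _ = M * ‖lam‖ ^ 2 * dt ^ α * ∑ k ∈ Finset.range n,
          ((k + 1 : ℝ) ^ α - (k : ℝ) ^ α) * coeffB α (k + 1) n := by
        rw [Finset.mul_sum, Finset.mul_sum]
        refine Finset.sum_congr rfl fun k _ => ?_
        rw [hnode]; ring
    _ ≤ M * ‖lam‖ ^ 2 * dt ^ α * (C * eta α n) := by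
        gcongr
        exact hS n hn
    _ = M * (C * eta α n) * ‖lam‖ ^ 2 * dt ^ α := by ring
    _ ≤ M * (C * eta α n) * ‖lam‖ ^ 2 * dt ^ α * (1 + ‖lam‖ * dt ^ α) :=
        le_mul_of_one_le_right (by positivity) (le_add_of_nonneg_right (by positivity))
    _ = _ := by ring
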